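/- Let $\mathbf{Sch}$ be the category of schemes, regarded as a full subcategory of the category $\mathbf{LRS}$ of locally ringed spaces. Then $\mathbf{Sch}$ has all finite inverse limits, and the inclusion $\mathbf{Sch}\to\mathbf{LRS}$ preserves them. Equivalently, every finite diagram of schemes has an inverse limit in $\mathbf{LRS}$, and every such inverse limit is a scheme. Moreover, finite products and equalizers have the following local description. (a) Let $(X_i)_{i\in I}$ be a finite family of schemes and let $X$, with projections $p_i : X\to X_i$, be its product in $\mathbf{LRS}$. Each point of $X$ lies in an open subspace of the form $\bigcap_i p_i^{-1}(U_i)$ with every $U_i\subseteq X_i$ affine open. For any affine opens $U_i=\operatorname{Spec}A_i\subseteq X_i$, the open subspace $\bigcap_i p_i^{-1}(U_i)$ of $X$ is isomorphic to $\operatorname{Spec}\bigl(\bigotimes_{i} A_i\bigr)$ (tensor product over $\mathbb{Z}$), in such a way that each $p_i$ restricts to the morphism $\operatorname{Spec}\bigl(\bigotimes_{j} A_j\bigr)\to\operatorname{Spec}A_i=U_i$ induced by the canonical ring homomorphism $A_i\to\bigotimes_{j} A_j$. (b) Let $f,g:Y\rightrightarrows Z$ be morphisms of schemes and let $\iota:X\to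 Y$ be their equalizer in $\mathbf{LRS}$. For each point $x\in X$ there are affine opens $V\subseteq Y$ and $W\subseteq Z$ with $\iota(x)\in V$, $f(V)\subseteq W$ and $g(V)\subseteq W$. For any affine opens $V=\operatorname{Spec}B\subseteq Y$ and $W=\operatorname{Spec}A\subseteq Z$ with $f(V)\subseteq W$ and $g(V)\subseteq W$, the open subspace $\iota^{-1}(V)$ of $X$ is isomorphic to $\operatorname{Spec}C$, where $$C = B/\langle f^{\sharp}(a)-g^{\sharp}(a) : a\in A\rangle$$ is the coequalizer of $f^{\sharp},g^{\sharp}:A\rightrightarrows B$ in commutative rings, in such a way that $\iota$ restricts to the morphism $\operatorname{Spec}C\to\operatorname{Spec}B=V$ induced by the quotient map $B\to C$. -/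

import Mathlib

open CategoryTheory CategoryTheory.Limits TopologicalSpace Opposite AlgebraicGeometry
open scoped TensorProduct

universe u

namespace SchemeLimits

/-- A locally ringed space is a scheme if every point has an open neighbourhood which is
isomorphic, as a locally ringed space, to the spectrum of a commutative ring. -/
def IsScheme (X : LocallyRingedSpace.{u}) : Prop :=
  ∀ x : X, ∃ (U : OpenNhds x) (R : CommRingCat.{u}),
    Nonempty (X.restrict U.isOpenEmbedding ≅ Spec.toLocallyRingedSpace.obj (op R))

/-- The tensor product over `ℤ` of a finite family of commutative rings. -/
noncomputable def tensorRing {ι : Type} (A : ι → CommRingCat.{u}) : CommRingCat.{u} :=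
  CommRingCat.of (⨂[ℤ] i, A i)

/-- The canonical ring homomorphism `A i ⟶ ⨂ A j`, `a ↦ 1 ⊗ ⋯ ⊗ a ⊗ ⋯ ⊗ 1`. -/
noncomputable def tensorRingIncl {ι : Type} [DecidableEq ι] (A : ι → CommRingCat.{u}) (i : ι) :
    A i ⟶ tensorRing A :=
  CommRingCat.ofHom
    (PiTensorProduct.singleAlgHom (R := ℤ) (A := fun j => (A j : Type u)) i).toRingHom

/-- The coequalizer ring `B / ⟨φ a - ψ a : a ∈ A⟩` of two ring homomorphisms `φ, ψ : A ⟶ B`. -/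
def coeqRing {A B : CommRingCat.{u}} (φ ψ : A ⟶ B) : CommRingCat.{u} :=
  CommRingCat.of (B ⧸ Ideal.span (Set.range fun a : A => φ.hom a - ψ.hom a))

/-- The quotient homomorphism onto the coequalizer ring. -/
def coeqRingProj {A B : CommRingCat.{u}} (φ ψ : A ⟶ B) : B ⟶ coeqRing φ ψ :=
  CommRingCat.ofHom (Ideal.Quotient.mk (Ideal.span (Set.range fun a : A => φ.hom a - ψ.hom a)))

/-- The open subspace of a product (in locally ringed spaces) of schemes that consists of the
points whose `i`-th projection lies in `U i` for every `i`. -/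
def boxOpen {ι : Type} {X : ι → Scheme.{u}}
    (c : Fan fun i => (X i).toLocallyRingedSpace) (U : ∀ i, (X i).Opens) :
    Opens c.pt.toTopCat :=
  ⨅ i, (Opens.map (c.proj i).base).obj (U i)

/-- The open subspace of an equalizer (in locally ringed spaces) of two morphisms of schemes that
consists of the points lying over `V`. -/
def forkOpen {Y Z : Scheme.{u}} {f g : Y ⟶ Z}
    (c : Fork f.toLRSHom g.toLRSHom) (V : Y.Opens) : Opens c.pt.toTopCat :=
  (Opens.map c.ι.base).obj V

end SchemeLimits

/-! Two facts carry the theorem. First, `Γ` and `Spec` are adjoint on all locally ringed spaces, so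
a morphism from `T` to an affine scheme is the same as a morphism of schemes from `Spec Γ(T)`.
Limits of affine schemes therefore test correctly against every `T`, not only against schemes.
Second, morphisms of locally ringed spaces glue along open covers of the source
(`hom_ext_of_openFamily`, `exists_glue_of_openFamily`).

Given a fibre product of schemes and a compatible pair of maps from `T`, each point of `T` has a
neighbourhood mapping into affine charts. There the lift exists uniquely by the first fact, and the
second glues these lifts (`isPullback_toLRSHom`). With the terminal object this gives all finite
limits. Limits in locally ringed spaces are unique up to isomorphism, so any such limit is a scheme.

The local descriptions (`exists_boxOpen_iso`, `exists_forkOpen_iso`) follow from the universal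
properties alone: tensor products and quotients are colimits of rings, the adjunction turns them
into limits, and maps with image in an open subspace factor through it. -/

namespace AlgebraicGeometry.LocallyRingedSpace

/-! ### Gluing morphisms of locally ringed spaces along open covers -/

section Gluing

variable {X : LocallyRingedSpace.{u}} {J : Type u} {U : J → LocallyRingedSpace.{u}}
  (f : ∀ i, U i ⟶ X) [∀ i, IsOpenImmersion (f i)]

/-- The transition maps on triple intersections for a family of open immersions. -/
noncomputable def openFamilyTransition (x y z : J) :
    pullback (pullback.fst (f x) (f y)) (pullback.fst (f x) (f z)) ⟶
      pullback (pullback.fst (f y) (f z)) (pullback.fst (f y) (f x)) :=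
  pullback.lift
    (pullback.lift (pullback.fst _ _ ≫ pullback.snd _ _) (pullback.snd _ _ ≫ pullback.snd _ _)
      (by
        rw [Category.assoc, Category.assoc, ← pullback.condition, ← pullback.condition,
          pullback.condition_assoc]))
    (pullback.fst _ _ ≫ (pullbackSymmetry _ _).hom) (by simp [pullback.lift_fst])

/-- The glue data of locally ringed spaces attached to a family of open immersions. -/
noncomputable def openFamilyGlueData : LocallyRingedSpace.GlueData.{u} where
  J := J
  U := U
  V := fun ⟨x, y⟩ => pullback (f x) (f y)
  f _ _ := pullback.fst _ _
  f_id _ := inferInstance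
  f_hasPullback _ _ _ := inferInstance
  t _ _ := (pullbackSymmetry _ _).hom
  t_id x := by
    apply pullback.hom_ext
    · simp
    · simp [← (cancel_mono (f x)).1 pullback.condition]
  t' x y z := openFamilyTransition f x y z
  t_fac x y z := by simp [openFamilyTransition, pullback.lift_snd]
  cocycle x y z := by
    apply pullback.hom_ext <;> apply pullback.hom_ext <;>
      simp [openFamilyTransition, pullback.condition, pullback.lift_fst_assoc,
        pullback.lift_snd_assoc, pullback.lift_fst, pullback.lift_snd]
  f_open _ _ := inferInstance

/-- The gluing of a family of open subspaces along their intersections. -/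
noncomputable def openFamilyGlued : LocallyRingedSpace.{u} := (openFamilyGlueData f).glued

/-- The inclusion of a member of a family of open subspaces into their gluing. -/
noncomputable def openFamilyι (i : J) : U i ⟶ openFamilyGlued f := (openFamilyGlueData f).ι i

instance (i : J) : IsOpenImmersion (openFamilyι f i) :=
  (openFamilyGlueData f).ι_isOpenImmersion i

theorem openFamilyι_jointly_surjective (x : openFamilyGlued f) :
    ∃ (i : J) (y : U i), (openFamilyι f i).base y = x :=
  (openFamilyGlueData f).ι_jointly_surjective x

theorem openFamily_glue_condition (i j : J) :
    pullback.snd (f i) (f j) ≫ openFamilyι f j = pullback.fst (f i) (f j) ≫ openFamilyι f i := by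
  rw [← pullbackSymmetry_hom_comp_fst, Category.assoc]
  exact (openFamilyGlueData f).glue_condition i j

/-- Compatible morphisms induce a morphism from the gluing of a family of open subspaces. -/
noncomputable def openFamilyDesc {Y : LocallyRingedSpace.{u}} (g : ∀ i, U i ⟶ Y)
    (hg : ∀ i j, pullback.fst (f i) (f j) ≫ g i = pullback.snd (f i) (f j) ≫ g j) :
    openFamilyGlued f ⟶ Y :=
  have h (i j : J) : pullback.fst (f i) (f j) ≫ g i =
      ((pullbackSymmetry (f i) (f j)).hom ≫ pullback.fst (f j) (f i)) ≫ g j := by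
    rw [pullbackSymmetry_hom_comp_fst, hg]
  Multicoequalizer.desc (openFamilyGlueData f).diagram _ g fun p => h p.1 p.2

theorem openFamilyι_desc {Y : LocallyRingedSpace.{u}} (g : ∀ i, U i ⟶ Y)
    (hg : ∀ i j, pullback.fst (f i) (f j) ≫ g i = pullback.snd (f i) (f j) ≫ g j) (i : J) :
    openFamilyι f i ≫ openFamilyDesc f g hg = g i :=
  Multicoequalizer.π_desc _ _ _ _ _

theorem openFamilyGlued_hom_ext {Y : LocallyRingedSpace.{u}} {g h : openFamilyGlued f ⟶ Y}
    (H : ∀ i, openFamilyι f i ≫ g = openFamilyι f i ≫ h) : g = h :=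
  Multicoequalizer.hom_ext _ _ _ H

/-- The canonical morphism from the gluing of a family of open subspaces. -/
noncomputable def fromOpenFamilyGlued : openFamilyGlued f ⟶ X :=
  openFamilyDesc f f fun _ _ => pullback.condition

theorem ι_fromOpenFamilyGlued (i : J) : openFamilyι f i ≫ fromOpenFamilyGlued f = f i :=
  openFamilyι_desc _ _ _ _

theorem fromOpenFamilyGlued_ι_apply (i : J) (x : U i) :
    (fromOpenFamilyGlued f).base ((openFamilyι f i).base x) = (f i).base x :=
  congr(($(ι_fromOpenFamilyGlued f i)).base x)

/-- The forgetful functor to topological spaces preserves pullbacks along open immersions, so points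
can be found in the topological fibre product. -/
theorem exists_pullback_of_base_eq {Y Z : LocallyRingedSpace.{u}} (g : Y ⟶ X) (h : Z ⟶ X)
    [IsOpenImmersion g] (x : Y) (y : Z) (e : g.base x = h.base y) :
    ∃ z : (pullback g h : LocallyRingedSpace.{u}),
      (pullback.fst g h).base z = x ∧ (pullback.snd g h).base z = y := by
  let e' := (TopCat.pullbackConeIsLimit _ _).conePointUniqueUpToIso
      (isLimitOfHasPullbackOfPreservesLimit
        (forgetToSheafedSpace ⋙ SheafedSpace.forget _) g h)
  refine ⟨e'.hom ⟨⟨x, y⟩, e⟩, ?_, ?_⟩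
  · exact congr($(IsLimit.conePointUniqueUpToIso_hom_comp (TopCat.pullbackConeIsLimit _ _)
      (isLimitOfHasPullbackOfPreservesLimit
        (forgetToSheafedSpace ⋙ SheafedSpace.forget _) g h) WalkingCospan.left) ⟨⟨x, y⟩, e⟩)
  · exact congr($(IsLimit.conePointUniqueUpToIso_hom_comp (TopCat.pullbackConeIsLimit _ _)
      (isLimitOfHasPullbackOfPreservesLimit
        (forgetToSheafedSpace ⋙ SheafedSpace.forget _) g h) WalkingCospan.right) ⟨⟨x, y⟩, e⟩)

theorem fromOpenFamilyGlued_injective : Function.Injective (fromOpenFamilyGlued f).base := by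
  intro x y h
  obtain ⟨i, x, rfl⟩ := openFamilyι_jointly_surjective f x
  obtain ⟨j, y, rfl⟩ := openFamilyι_jointly_surjective f y
  rw [fromOpenFamilyGlued_ι_apply, fromOpenFamilyGlued_ι_apply] at h
  obtain ⟨z, rfl, rfl⟩ := exists_pullback_of_base_eq _ _ x y h
  exact congr(($(openFamily_glue_condition f i j)).base z).symm

/-- Two out of three: `openFamilyι f i` and its composite `f i` are both open immersions, hence
isomorphisms on stalks. -/
instance (x : openFamilyGlued f) : IsIso ((fromOpenFamilyGlued f).stalkMap x) := by
  obtain ⟨i, x, rfl⟩ := openFamilyι_jointly_surjective f x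
  have h₁ : IsIso ((openFamilyι f i ≫ fromOpenFamilyGlued f).stalkMap x) := by
    rw [ι_fromOpenFamilyGlued]
    infer_instance
  have h₂ := stalkMap_comp (openFamilyι f i) (fromOpenFamilyGlued f) x
  have h₃ : IsIso ((fromOpenFamilyGlued f).stalkMap ((openFamilyι f i).base x) ≫
      (openFamilyι f i).stalkMap x) := h₂ ▸ h₁
  exact IsIso.of_isIso_comp_right _ ((openFamilyι f i).stalkMap x)

theorem isOpenMap_fromOpenFamilyGlued : IsOpenMap (fromOpenFamilyGlued f).base := by
  intro V hV
  have : (fromOpenFamilyGlued f).base '' V =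
      ⋃ i : J, (f i).base '' ((openFamilyι f i).base ⁻¹' V) := by
    ext y
    simp only [Set.mem_image, Set.mem_iUnion]
    constructor
    · rintro ⟨x, hx, rfl⟩
      obtain ⟨i, x, rfl⟩ := openFamilyι_jointly_surjective f x
      exact ⟨i, x, hx, (fromOpenFamilyGlued_ι_apply f i x).symm⟩
    · rintro ⟨i, x, hx, rfl⟩
      exact ⟨_, hx, fromOpenFamilyGlued_ι_apply f i x⟩
  rw [this]
  exact isOpen_iUnion fun i =>
    (PresheafedSpace.IsOpenImmersion.base_open (f := (f i).toHom)).isOpenMap _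
      (hV.preimage (openFamilyι f i).base.hom.continuous)

/-- An open embedding that is an isomorphism on stalks is an open immersion, and a surjective open
immersion is an isomorphism. Thus a space is the gluing of any open cover, and inherits its
universal property as a colimit. -/
theorem isIso_fromOpenFamilyGlued (hf : ∀ x : X, ∃ i, x ∈ Set.range (f i).base) :
    IsIso (fromOpenFamilyGlued f) := by
  have := IsOpenImmersion.of_stalk_iso (fromOpenFamilyGlued f)
    (.of_continuous_injective_isOpenMap (fromOpenFamilyGlued f).base.hom.continuous
      (fromOpenFamilyGlued_injective f) (isOpenMap_fromOpenFamilyGlued f))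
  have : Epi (fromOpenFamilyGlued f).base := by
    rw [TopCat.epi_iff_surjective]
    intro x
    obtain ⟨i, x, rfl⟩ := hf x
    exact ⟨_, fromOpenFamilyGlued_ι_apply f i x⟩
  exact IsOpenImmersion.to_iso _

include f in
/-- Morphisms of locally ringed spaces that agree on a jointly surjective family of open
immersions are equal. -/
theorem hom_ext_of_openFamily (hf : ∀ x : X, ∃ i, x ∈ Set.range (f i).base)
    {Y : LocallyRingedSpace.{u}} {g h : X ⟶ Y} (H : ∀ i, f i ≫ g = f i ≫ h) : g = h := by
  have := isIso_fromOpenFamilyGlued f hf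
  rw [← cancel_epi (fromOpenFamilyGlued f)]
  refine openFamilyGlued_hom_ext f fun i => ?_
  rw [← Category.assoc, ← Category.assoc, ι_fromOpenFamilyGlued, H]

/-- Compatible morphisms on a jointly surjective family of open immersions glue. -/
theorem exists_glue_of_openFamily (hf : ∀ x : X, ∃ i, x ∈ Set.range (f i).base)
    {Y : LocallyRingedSpace.{u}} (g : ∀ i, U i ⟶ Y)
    (hg : ∀ i j, pullback.fst (f i) (f j) ≫ g i = pullback.snd (f i) (f j) ≫ g j) :
    ∃ h : X ⟶ Y, ∀ i, f i ≫ h = g i := by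
  have := isIso_fromOpenFamilyGlued f hf
  refine ⟨inv (fromOpenFamilyGlued f) ≫ openFamilyDesc f g hg, fun i => ?_⟩
  conv_lhs => enter [1]; rw [← ι_fromOpenFamilyGlued f i]
  rw [Category.assoc, IsIso.hom_inv_id_assoc, openFamilyι_desc]

end Gluing

end AlgebraicGeometry.LocallyRingedSpace

namespace AlgebraicGeometry.LocallyRingedSpace

/-! ### Morphisms into affine schemes -/

/-- The canonical morphism to the spectrum of the ring of global sections, as a scheme. -/
noncomputable def toSpecGlobalSections (T : LocallyRingedSpace.{u}) :
    T ⟶ (Spec (Γ.obj (op T))).toLocallyRingedSpace :=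
  T.toΓSpec

theorem toSpecGlobalSections_comp_bijective (T : LocallyRingedSpace.{u}) (R : CommRingCat.{u}) :
    Function.Bijective fun φ : R ⟶ Γ.obj (op T) =>
      T.toSpecGlobalSections ≫ (Spec.map φ).toLRSHom := by
  have h := (ΓSpec.locallyRingedSpaceAdjunction.homEquiv T (op R)).bijective
  exact h.comp ⟨fun _ _ e => Quiver.Hom.op_inj e, fun x => ⟨x.unop, rfl⟩⟩

/-- Every morphism from a locally ringed space to an affine scheme factors uniquely through the
spectrum of the ring of global sections. -/
theorem existsUnique_toSpecGlobalSections_comp (T : LocallyRingedSpace.{u}) (X : Scheme.{u})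
    [IsAffine X] (a : T ⟶ X.toLocallyRingedSpace) :
    ∃! b : Spec (Γ.obj (op T)) ⟶ X, T.toSpecGlobalSections ≫ b.toLRSHom = a := by
  have hb := toSpecGlobalSections_comp_bijective T Γ(X, ⊤)
  obtain ⟨φ, hφ⟩ := hb.2 (a ≫ X.isoSpec.hom.toLRSHom)
  have hm : Mono X.isoSpec.hom.toLRSHom :=
    inferInstanceAs (Mono (Scheme.forgetToLocallyRingedSpace.map X.isoSpec.hom))
  refine ⟨Spec.map φ ≫ X.isoSpec.inv, ?_, fun c hc => ?_⟩
  · dsimp only at hφ ⊢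
    rw [← cancel_mono X.isoSpec.hom.toLRSHom, Category.assoc, ← Scheme.Hom.comp_toLRSHom,
      Category.assoc, Iso.inv_hom_id, Category.comp_id, hφ]
  · obtain ⟨ψ, hψ⟩ := Spec.map_surjective (c ≫ X.isoSpec.hom)
    rw [Iso.eq_comp_inv, ← hψ]
    congr 1
    apply hb.1
    dsimp only at hφ hc ⊢
    rw [hψ, hφ, Scheme.Hom.comp_toLRSHom, ← Category.assoc, hc]

/-! ### Fibre products -/

section Pullback

variable {P X Y S : Scheme.{u}} {p : P ⟶ X} {q : P ⟶ Y} {f : X ⟶ S} {g : Y ⟶ S}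

/-- All morphisms involved have affine targets, so they factor through the scheme `Spec Γ(T)`, where
the universal property among schemes applies. -/
theorem existsUnique_lift_of_isAffine (H : IsPullback p q f g) [IsAffine X] [IsAffine Y]
    [IsAffine S] {T : LocallyRingedSpace.{u}} (a : T ⟶ X.toLocallyRingedSpace)
    (b : T ⟶ Y.toLocallyRingedSpace) (w : a ≫ f.toLRSHom = b ≫ g.toLRSHom) :
    ∃! l : T ⟶ P.toLocallyRingedSpace, l ≫ p.toLRSHom = a ∧ l ≫ q.toLRSHom = b := by
  have : IsAffine P := .of_isIso H.isoPullback.hom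
  obtain ⟨a, rfl, ha⟩ := existsUnique_toSpecGlobalSections_comp T X a
  obtain ⟨b, rfl, hb⟩ := existsUnique_toSpecGlobalSections_comp T Y b
  have w' : a ≫ f = b ≫ g :=
    (existsUnique_toSpecGlobalSections_comp T S _).unique (y₁ := a ≫ f) (y₂ := b ≫ g)
      (Category.assoc _ _ _).symm ((Category.assoc _ _ _).symm.trans w.symm)
  refine ⟨T.toSpecGlobalSections ≫ (H.lift a b w').toLRSHom, ⟨?_, ?_⟩, ?_⟩
  · rw [Category.assoc, ← Scheme.Hom.comp_toLRSHom, H.lift_fst]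
  · rw [Category.assoc, ← Scheme.Hom.comp_toLRSHom, H.lift_snd]
  · rintro l ⟨h₁, h₂⟩
    obtain ⟨l, rfl, -⟩ := existsUnique_toSpecGlobalSections_comp T P l
    have h₁ : l ≫ p = a := ha _ ((Category.assoc _ _ _).symm.trans h₁)
    have h₂ : l ≫ q = b := hb _ ((Category.assoc _ _ _).symm.trans h₂)
    have : l = H.lift a b w' :=
      H.hom_ext (by rw [h₁, H.lift_fst]) (by rw [h₂, H.lift_snd])
    rw [this]

theorem exists_lift_opens {X : Scheme.{u}} (U : X.Opens) {T : LocallyRingedSpace.{u}}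
    (a : T ⟶ X.toLocallyRingedSpace) (h : ∀ t, a.base t ∈ U) :
    ∃ a' : T ⟶ U.toScheme.toLocallyRingedSpace, a' ≫ U.ι.toLRSHom = a := by
  have : IsOpenImmersion U.ι.toLRSHom := inferInstanceAs (AlgebraicGeometry.IsOpenImmersion U.ι)
  have hr : Set.range a.base ⊆ Set.range U.ι.toLRSHom.base := by
    rintro _ ⟨t, rfl⟩
    exact ⟨⟨_, h t⟩, rfl⟩
  exact ⟨IsOpenImmersion.lift _ _ hr, IsOpenImmersion.lift_fac _ _ hr⟩

instance mono_opens_ι {X : Scheme.{u}} (U : X.Opens) : Mono U.ι.toLRSHom :=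
  have : IsOpenImmersion U.ι.toLRSHom := inferInstanceAs (AlgebraicGeometry.IsOpenImmersion U.ι)
  inferInstance

/-- The open subscheme `p ⁻¹ᵁ U ⊓ q ⁻¹ᵁ V` of `P` is the fibre product of `U` and `V` over `W`,
which reduces the claim to the affine case. -/
theorem existsUnique_lift_of_isAffineOpen (H : IsPullback p q f g) {U : X.Opens} {V : Y.Opens}
    {W : S.Opens} (hU : IsAffineOpen U) (hV : IsAffineOpen V) (hW : IsAffineOpen W)
    (hf : U ≤ f ⁻¹ᵁ W) (hg : V ≤ g ⁻¹ᵁ W)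
    {T : LocallyRingedSpace.{u}} (a : T ⟶ X.toLocallyRingedSpace)
    (b : T ⟶ Y.toLocallyRingedSpace) (w : a ≫ f.toLRSHom = b ≫ g.toLRSHom)
    (ha : ∀ t, a.base t ∈ U) (hb : ∀ t, b.base t ∈ V) :
    ∃! l : T ⟶ P.toLocallyRingedSpace, l ≫ p.toLRSHom = a ∧ l ≫ q.toLRSHom = b := by
  have : IsAffine U := hU
  have : IsAffine V := hV
  have : IsAffine W := hW
  have H' := Scheme.Hom.isPullback_resLE H hg hf rfl
  have hfW := congr(($(f.resLE_comp_ι hf)).toLRSHom)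
  have hgW := congr(($(g.resLE_comp_ι hg)).toLRSHom)
  have hpU := congr(($(p.resLE_comp_ι (U := U) (V := p ⁻¹ᵁ U ⊓ q ⁻¹ᵁ V) (by simp))).toLRSHom)
  have hqV := congr(($(q.resLE_comp_ι (U := V) (V := p ⁻¹ᵁ U ⊓ q ⁻¹ᵁ V) (by simp))).toLRSHom)
  rw [Scheme.Hom.comp_toLRSHom, Scheme.Hom.comp_toLRSHom] at hfW hgW hpU hqV
  obtain ⟨a, rfl⟩ := exists_lift_opens U a ha
  obtain ⟨b, rfl⟩ := exists_lift_opens V b hb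
  have w' : a ≫ (f.resLE W U hf).toLRSHom = b ≫ (g.resLE W V hg).toLRSHom := by
    rw [← cancel_mono W.ι.toLRSHom, Category.assoc, Category.assoc, hfW, hgW]
    simpa only [Category.assoc] using w
  obtain ⟨l, ⟨h₁, h₂⟩, h₃⟩ := existsUnique_lift_of_isAffine H' a b w'
  refine ⟨l ≫ (p ⁻¹ᵁ U ⊓ q ⁻¹ᵁ V).ι.toLRSHom, ⟨?_, ?_⟩, ?_⟩
  · rw [Category.assoc, ← hpU, ← h₁, Category.assoc]
  · rw [Category.assoc, ← hqV, ← h₂, Category.assoc]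
  · rintro m ⟨h₁', h₂'⟩
    -- A competing lift has its image in the same open subscheme, so uniqueness there applies to it.
    obtain ⟨m, rfl⟩ := exists_lift_opens (p ⁻¹ᵁ U ⊓ q ⁻¹ᵁ V) m fun t =>
      ⟨by have := ha t; rw [← h₁'] at this; exact this,
        by have := hb t; rw [← h₂'] at this; exact this⟩
    rw [h₃ m ⟨?_, ?_⟩]
    · rw [← cancel_mono U.ι.toLRSHom, ← h₁', Category.assoc, hpU, Category.assoc]
    · rw [← cancel_mono V.ι.toLRSHom, ← h₂', Category.assoc, hqV, Category.assoc]

theorem exists_affine_chart (f : X ⟶ S) (g : Y ⟶ S) (x : X) (y : Y) (h : f x = g y) :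
    ∃ (U : X.Opens) (V : Y.Opens) (W : S.Opens), IsAffineOpen U ∧ IsAffineOpen V ∧
      IsAffineOpen W ∧ U ≤ f ⁻¹ᵁ W ∧ V ≤ g ⁻¹ᵁ W ∧ x ∈ U ∧ y ∈ V := by
  obtain ⟨W, hW, hxW, -⟩ := exists_isAffineOpen_mem_and_subset (x := f x) (U := ⊤) trivial
  obtain ⟨U, hU, hxU, hUW⟩ := exists_isAffineOpen_mem_and_subset (x := x) (U := f ⁻¹ᵁ W) hxW
  obtain ⟨V, hV, hyV, hVW⟩ := exists_isAffineOpen_mem_and_subset (x := y) (U := g ⁻¹ᵁ W)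
    (show g y ∈ W from h ▸ hxW)
  exact ⟨U, V, W, hU, hV, hW, hUW, hVW, hxU, hyV⟩

theorem mem_range_ofRestrict (T : LocallyRingedSpace.{u}) (O : Opens T.toTopCat) {t : T}
    (ht : t ∈ O) : t ∈ Set.range (T.ofRestrict O.isOpenEmbedding).base :=
  ⟨⟨t, ht⟩, rfl⟩

theorem existsUnique_lift_restrict (H : IsPullback p q f g) {T : LocallyRingedSpace.{u}}
    (a : T ⟶ X.toLocallyRingedSpace) (b : T ⟶ Y.toLocallyRingedSpace)
    (w : a ≫ f.toLRSHom = b ≫ g.toLRSHom) (t : T) :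
    ∃ O : Opens T.toTopCat, t ∈ O ∧
      ∃! l : T.restrict O.isOpenEmbedding ⟶ P.toLocallyRingedSpace,
        l ≫ p.toLRSHom = T.ofRestrict O.isOpenEmbedding ≫ a ∧
        l ≫ q.toLRSHom = T.ofRestrict O.isOpenEmbedding ≫ b := by
  obtain ⟨U, V, W, hU, hV, hW, hf, hg, hx, hy⟩ :=
    exists_affine_chart f g (a.base t) (b.base t) congr(($w).base t)
  refine ⟨(Opens.map a.base).obj U ⊓ (Opens.map b.base).obj V, ⟨hx, hy⟩, ?_⟩
  exact existsUnique_lift_of_isAffineOpen H hU hV hW hf hg _ _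
    (by rw [Category.assoc, w, Category.assoc]) (fun t => t.2.1) (fun t => t.2.2)

/-- Uniqueness for arbitrary `T` comes before existence: it is what makes the local lifts agree on
overlaps. -/
theorem hom_ext_of_isPullback (H : IsPullback p q f g) {T : LocallyRingedSpace.{u}}
    {h h' : T ⟶ P.toLocallyRingedSpace} (h₁ : h ≫ p.toLRSHom = h' ≫ p.toLRSHom)
    (h₂ : h ≫ q.toLRSHom = h' ≫ q.toLRSHom) : h = h' := by
  have w : (h ≫ p.toLRSHom) ≫ f.toLRSHom = (h ≫ q.toLRSHom) ≫ g.toLRSHom := by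
    rw [Category.assoc, Category.assoc, ← Scheme.Hom.comp_toLRSHom, H.w,
      Scheme.Hom.comp_toLRSHom]
  choose O hO l _ hl using existsUnique_lift_restrict H _ _ w
  refine hom_ext_of_openFamily (fun t => T.ofRestrict (O t).isOpenEmbedding)
    (fun t => ⟨t, mem_range_ofRestrict T _ (hO t)⟩) fun t => ?_
  rw [hl t _ ⟨Category.assoc _ _ _, Category.assoc _ _ _⟩]
  refine (hl t _ ⟨?_, ?_⟩).symm
  · rw [h₁, Category.assoc]
  · rw [h₂, Category.assoc]

theorem exists_lift_of_isPullback (H : IsPullback p q f g) {T : LocallyRingedSpace.{u}}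
    (a : T ⟶ X.toLocallyRingedSpace) (b : T ⟶ Y.toLocallyRingedSpace)
    (w : a ≫ f.toLRSHom = b ≫ g.toLRSHom) :
    ∃ l : T ⟶ P.toLocallyRingedSpace, l ≫ p.toLRSHom = a ∧ l ≫ q.toLRSHom = b := by
  choose O hO l hl _ using existsUnique_lift_restrict H _ _ w
  have hc (t : T) := mem_range_ofRestrict T _ (hO t)
  obtain ⟨m, hm⟩ := exists_glue_of_openFamily (fun t => T.ofRestrict (O t).isOpenEmbedding)
    (fun t => ⟨t, hc t⟩) l fun s t => hom_ext_of_isPullback H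
      (by rw [Category.assoc, Category.assoc, (hl s).1, (hl t).1, pullback.condition_assoc])
      (by rw [Category.assoc, Category.assoc, (hl s).2, (hl t).2, pullback.condition_assoc])
  refine ⟨m, ?_, ?_⟩ <;>
    refine hom_ext_of_openFamily (fun t => T.ofRestrict (O t).isOpenEmbedding)
      (fun t => ⟨t, hc t⟩) fun t => ?_
  · rw [← Category.assoc, hm, (hl t).1]
  · rw [← Category.assoc, hm, (hl t).2]

/-- Fibre products of schemes are fibre products of locally ringed spaces. -/
theorem isPullback_toLRSHom (H : IsPullback p q f g) :
    IsPullback p.toLRSHom q.toLRSHom f.toLRSHom g.toLRSHom where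
  w := congr(($(H.w)).toLRSHom)
  isLimit' := ⟨PullbackCone.IsLimit.mk _
    (fun s => (exists_lift_of_isPullback H s.fst s.snd s.condition).choose)
    (fun s => (exists_lift_of_isPullback H s.fst s.snd s.condition).choose_spec.1)
    (fun s => (exists_lift_of_isPullback H s.fst s.snd s.condition).choose_spec.2)
    (fun s _ h₁ h₂ => hom_ext_of_isPullback H
      (h₁.trans (exists_lift_of_isPullback H s.fst s.snd s.condition).choose_spec.1.symm)
      (h₂.trans (exists_lift_of_isPullback H s.fst s.snd s.condition).choose_spec.2.symm))⟩

end Pullback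

/-! ### Preservation of finite limits -/

/-- The terminal scheme is terminal among locally ringed spaces. -/
noncomputable def isTerminalTerminalScheme :
    IsTerminal (⊤_ Scheme.{u}).toLocallyRingedSpace :=
  IsTerminal.ofUniqueHom
    (fun T => T.toSpecGlobalSections ≫ (terminal.from (Spec (Γ.obj (op T)))).toLRSHom)
    fun T a => by
      obtain ⟨b, rfl, -⟩ := existsUnique_toSpecGlobalSections_comp T (⊤_ Scheme.{u}) a
      rw [Subsingleton.elim b (terminal.from _)]

instance preservesFiniteLimits_forgetToLocallyRingedSpace :
    PreservesFiniteLimits Scheme.forgetToLocallyRingedSpace.{u} := by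
  have : HasTerminal LocallyRingedSpace.{u} := isTerminalTerminalScheme.hasTerminal
  have : PreservesLimit (Functor.empty.{0} Scheme.{u}) Scheme.forgetToLocallyRingedSpace :=
    preservesTerminal_of_iso _ (isTerminalTerminalScheme.uniqueUpToIso terminalIsTerminal)
  have : PreservesLimitsOfShape (Discrete.{0} PEmpty) Scheme.forgetToLocallyRingedSpace.{u} :=
    preservesLimitsOfShape_pempty_of_preservesTerminal _
  have (X Y S : Scheme.{u}) (f : X ⟶ S) (g : Y ⟶ S) :
      PreservesLimit (cospan f g) Scheme.forgetToLocallyRingedSpace.{u} :=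
    preservesLimit_of_preserves_limit_cone (IsPullback.of_hasPullback f g).isLimit
      ((isLimitMapConePullbackConeEquiv _ pullback.condition).symm
        (isPullback_toLRSHom (IsPullback.of_hasPullback f g)).isLimit)
  have : PreservesLimitsOfShape WalkingCospan Scheme.forgetToLocallyRingedSpace.{u} :=
    ⟨fun {K} => preservesLimit_of_iso_diagram _ (diagramIsoCospan K).symm⟩
  exact preservesFiniteLimits_of_preservesTerminal_and_pullbacks _

end AlgebraicGeometry.LocallyRingedSpace

/-! ### Invariance under isomorphism, and affine models of products and equalizers -/

namespace SchemeLimits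

/-- A locally ringed space isomorphic to a scheme is a scheme. -/
theorem isScheme_of_iso {X : LocallyRingedSpace.{u}} {S : Scheme.{u}}
    (e : X ≅ S.toLocallyRingedSpace) : IsScheme X := by
  intro x
  obtain ⟨U, R, ⟨i⟩⟩ := S.local_affine (e.hom.base x)
  let V : OpenNhds x := ⟨(Opens.map e.hom.base).obj U.1, U.2⟩
  let f : X.restrict V.isOpenEmbedding ⟶ S.toLocallyRingedSpace :=
    X.ofRestrict V.isOpenEmbedding ≫ e.hom
  let g := S.toLocallyRingedSpace.ofRestrict U.isOpenEmbedding
  have hfg : Set.range f.base ⊆ Set.range g.base := by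
    rintro _ ⟨y, rfl⟩
    exact ⟨⟨_, y.2⟩, rfl⟩
  have hgf : Set.range g.base ⊆ Set.range f.base := by
    rintro _ ⟨y, rfl⟩
    have hy : e.hom.base (e.inv.base (g.base y)) = g.base y :=
      LocallyRingedSpace.iso_inv_base_hom_base_apply e _
    exact ⟨⟨e.inv.base (g.base y), show e.hom.base _ ∈ U.1 by rw [hy]; exact y.2⟩, hy⟩
  have hf : LocallyRingedSpace.IsOpenImmersion f := inferInstance
  have hg : LocallyRingedSpace.IsOpenImmersion g := inferInstance
  -- Two open immersions into `S` with the same image have isomorphic sources.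
  exact ⟨V, R, ⟨{
    hom := LocallyRingedSpace.IsOpenImmersion.lift g f hfg
    inv := LocallyRingedSpace.IsOpenImmersion.lift f g hgf
    hom_inv_id := by simp [← cancel_mono f]
    inv_hom_id := by simp [← cancel_mono g] } ≪≫ i⟩⟩

/-- The tensor product is the coproduct of commutative rings: the induced map sends a pure tensor to
the product of the images of its factors. -/
theorem existsUnique_tensorRing_hom {ι : Type} [Fintype ι] [DecidableEq ι]
    (A : ι → CommRingCat.{u}) {R : CommRingCat.{u}} (φ : ∀ i, A i ⟶ R) :
    ∃! ψ : tensorRing A ⟶ R, ∀ i, tensorRingIncl A i ≫ ψ = φ i := by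
  let m : MultilinearMap ℤ (fun i => (A i : Type u)) R :=
    (MultilinearMap.mkPiAlgebra ℤ ι R).compLinearMap fun i => (φ i).hom.toIntAlgHom.toLinearMap
  have hm (x : ∀ i, A i) : m x = ∏ i, (φ i).hom (x i) := rfl
  let ψ : (⨂[ℤ] i, A i) →ₐ[ℤ] R := PiTensorProduct.liftAlgHom m
    (by simp [hm]) (fun x y => by simp [hm, Finset.prod_mul_distrib])
  refine ⟨CommRingCat.ofHom ψ.toRingHom, fun i => ?_, fun χ hχ => ?_⟩
  · ext a
    change PiTensorProduct.lift m (PiTensorProduct.tprod ℤ (Pi.mulSingle i a)) = (φ i).hom a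
    rw [PiTensorProduct.lift.tprod, hm, Finset.prod_eq_single i]
    · simp
    · intro j _ hj
      simp [Pi.mulSingle_eq_of_ne hj]
    · simp
  · let χ' : (⨂[ℤ] i, A i) →+* R := χ.hom
    -- A ring homomorphism is automatically `ℤ`-linear, so the extensionality of algebra maps on the
    -- tensor product applies.
    have : ({ χ' with commutes' := fun n => by simp } : (⨂[ℤ] i, A i) →ₐ[ℤ] R) = ψ := by
      refine PiTensorProduct.algHom_ext fun i => AlgHom.ext fun a => ?_
      refine (congr(($(hχ i)).hom a)).trans ?_
      change (φ i).hom a = PiTensorProduct.lift m (PiTensorProduct.tprod ℤ (Pi.mulSingle i a))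
      rw [PiTensorProduct.lift.tprod, hm, Finset.prod_eq_single i]
      · simp
      · intro j _ hj
        simp [Pi.mulSingle_eq_of_ne hj]
      · simp
    exact CommRingCat.hom_ext (RingHom.ext fun a => congr($this a))

theorem existsUnique_lift_Spec_tensorRing {ι : Type} [Fintype ι] [DecidableEq ι]
    (A : ι → CommRingCat.{u}) {T : LocallyRingedSpace.{u}}
    (a : ∀ i, T ⟶ (Spec (A i)).toLocallyRingedSpace) :
    ∃! l : T ⟶ (Spec (tensorRing A)).toLocallyRingedSpace,
      ∀ i, l ≫ (Spec.map (tensorRingIncl A i)).toLRSHom = a i := by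
  have hb := T.toSpecGlobalSections_comp_bijective
  choose φ hφ using fun i => (hb (A i)).2 (a i)
  dsimp only at hφ
  obtain ⟨ψ, hψ, hψ'⟩ := existsUnique_tensorRing_hom A φ
  refine ⟨T.toSpecGlobalSections ≫ (Spec.map ψ).toLRSHom, fun i => ?_, fun l hl => ?_⟩
  · rw [Category.assoc, ← Scheme.Hom.comp_toLRSHom, ← Spec.map_comp, hψ, hφ]
  · obtain ⟨χ, rfl⟩ := (hb _).2 l
    dsimp only at hl ⊢
    rw [hψ' χ fun i => (hb (A i)).1 ?_]
    dsimp only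
    rw [hφ, ← hl i, Category.assoc, ← Scheme.Hom.comp_toLRSHom, ← Spec.map_comp]

theorem coeqRing_condition {A B : CommRingCat.{u}} (φ ψ : A ⟶ B) :
    φ ≫ coeqRingProj φ ψ = ψ ≫ coeqRingProj φ ψ := by
  ext a
  exact Ideal.Quotient.eq.2 (Ideal.subset_span ⟨a, rfl⟩)

theorem existsUnique_coeqRing_hom {A B R : CommRingCat.{u}} (φ ψ : A ⟶ B) (θ : B ⟶ R)
    (h : φ ≫ θ = ψ ≫ θ) : ∃! χ : coeqRing φ ψ ⟶ R, coeqRingProj φ ψ ≫ χ = θ := by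
  have hI : Ideal.span (Set.range fun a : A => φ.hom a - ψ.hom a) ≤ RingHom.ker θ.hom := by
    rw [Ideal.span_le]
    rintro _ ⟨a, rfl⟩
    have : θ.hom (φ.hom a) = θ.hom (ψ.hom a) := congr(($h).hom a)
    simp [RingHom.mem_ker, this]
  refine ⟨CommRingCat.ofHom (Ideal.Quotient.lift _ θ.hom hI), by ext; rfl, fun χ hχ => ?_⟩
  ext x
  obtain ⟨b, rfl⟩ := Ideal.Quotient.mk_surjective x
  exact congr(($hχ).hom b)

theorem existsUnique_lift_Spec_coeqRing {A B : CommRingCat.{u}} (φ ψ : A ⟶ B)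
    {T : LocallyRingedSpace.{u}} (a : T ⟶ (Spec B).toLocallyRingedSpace)
    (h : a ≫ (Spec.map φ).toLRSHom = a ≫ (Spec.map ψ).toLRSHom) :
    ∃! l : T ⟶ (Spec (coeqRing φ ψ)).toLocallyRingedSpace,
      l ≫ (Spec.map (coeqRingProj φ ψ)).toLRSHom = a := by
  have hb := T.toSpecGlobalSections_comp_bijective
  obtain ⟨θ, rfl⟩ := (hb _).2 a
  dsimp only at h ⊢
  simp only [Category.assoc, ← Scheme.Hom.comp_toLRSHom, ← Spec.map_comp] at h
  obtain ⟨χ, hχ, hχ'⟩ := existsUnique_coeqRing_hom φ ψ θ ((hb A).1 h)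
  refine ⟨T.toSpecGlobalSections ≫ (Spec.map χ).toLRSHom, ?_, fun l hl => ?_⟩
  · dsimp only
    rw [Category.assoc, ← Scheme.Hom.comp_toLRSHom, ← Spec.map_comp, hχ]
  · obtain ⟨χ', rfl⟩ := (hb _).2 l
    dsimp only at hl ⊢
    rw [hχ' χ' ((hb B).1 ?_)]
    dsimp only
    rw [← hl, Category.assoc, ← Scheme.Hom.comp_toLRSHom, ← Spec.map_comp]

instance isOpenImmersion_fromSpec_toLRSHom {X : Scheme.{u}} {U : X.Opens} (hU : IsAffineOpen U) :
    LocallyRingedSpace.IsOpenImmersion hU.fromSpec.toLRSHom :=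
  inferInstanceAs (AlgebraicGeometry.IsOpenImmersion hU.fromSpec)

theorem exists_lift_fromSpec {X : Scheme.{u}} {U : X.Opens} (hU : IsAffineOpen U)
    {T : LocallyRingedSpace.{u}} (a : T ⟶ X.toLocallyRingedSpace) (h : ∀ t, a.base t ∈ U) :
    ∃ b : T ⟶ (Spec Γ(X, U)).toLocallyRingedSpace, b ≫ hU.fromSpec.toLRSHom = a := by
  have hr : Set.range a.base ⊆ Set.range hU.fromSpec.toLRSHom.base := by
    rintro _ ⟨t, rfl⟩
    exact hU.range_fromSpec.ge (h t)
  exact ⟨_, LocallyRingedSpace.IsOpenImmersion.lift_fac _ _ hr⟩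

theorem exists_lift_restrict {X T : LocallyRingedSpace.{u}} (O : Opens X.toTopCat) (a : T ⟶ X)
    (h : ∀ t, a.base t ∈ O) :
    ∃ b : T ⟶ X.restrict O.isOpenEmbedding, b ≫ X.ofRestrict O.isOpenEmbedding = a := by
  have hr : Set.range a.base ⊆ Set.range (X.ofRestrict O.isOpenEmbedding).base := by
    rintro _ ⟨t, rfl⟩
    exact ⟨⟨_, h t⟩, rfl⟩
  exact ⟨_, LocallyRingedSpace.IsOpenImmersion.lift_fac _ _ hr⟩

theorem fromSpec_mem {X : Scheme.{u}} {U : X.Opens} (hU : IsAffineOpen U)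
    (t : Spec Γ(X, U)) : hU.fromSpec t ∈ U :=
  hU.range_fromSpec.le ⟨t, rfl⟩

/-! ### Local structure of products -/

section Product

variable {ι : Type} [Fintype ι] {X : ι → Scheme.{u}}
  (c : Fan fun i => (X i).toLocallyRingedSpace)

theorem mem_boxOpen (U : ∀ i, (X i).Opens) (x : c.pt) :
    x ∈ boxOpen c U ↔ ∀ i, (c.proj i).base x ∈ U i := by
  rw [boxOpen, ← SetLike.mem_coe, Opens.coe_iInf, Set.mem_iInter]
  rfl

theorem exists_mem_boxOpen (x : c.pt) :
    ∃ U : ∀ i, (X i).Opens, (∀ i, IsAffineOpen (U i)) ∧ x ∈ boxOpen c U := by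
  choose U hU hxU _ using fun i => exists_isAffineOpen_mem_and_subset
    (x := ((c.proj i).base x : X i)) (U := ⊤) trivial
  exact ⟨U, hU, (mem_boxOpen c U x).2 hxU⟩

/-- A map to the box is a family of maps to the `X i` with image in `U i`, that is, a family of maps
to the spectra of the `Γ(X i, U i)`. The spectrum of the tensor product classifies the same data. -/
theorem exists_boxOpen_iso [DecidableEq ι] (hc : IsLimit c) (U : ∀ i, (X i).Opens)
    (hU : ∀ i, IsAffineOpen (U i)) :
    ∃ e : c.pt.restrict (boxOpen c U).isOpenEmbedding ≅
        (Spec (tensorRing fun i => Γ(X i, U i))).toLocallyRingedSpace,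
      ∀ i, c.pt.ofRestrict (boxOpen c U).isOpenEmbedding ≫ c.proj i =
        e.hom ≫ (Spec.map (tensorRingIncl (fun i => Γ(X i, U i)) i) ≫
          (hU i).fromSpec).toLRSHom := by
  choose a ha using fun i => exists_lift_fromSpec (hU i)
    (c.pt.ofRestrict (boxOpen c U).isOpenEmbedding ≫ c.proj i)
    fun t => (mem_boxOpen c U _).1 t.2 i
  obtain ⟨l, hl, -⟩ := existsUnique_lift_Spec_tensorRing _ a
  let m := Fan.IsLimit.lift hc fun i =>
    (Spec.map (tensorRingIncl (fun i => Γ(X i, U i)) i) ≫ (hU i).fromSpec).toLRSHom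
  have hm (i : ι) : m ≫ c.proj i = (Spec.map (tensorRingIncl (fun i => Γ(X i, U i)) i)).toLRSHom ≫
      (hU i).fromSpec.toLRSHom := Fan.IsLimit.fac hc _ i
  obtain ⟨m', hm'⟩ := exists_lift_restrict (boxOpen c U) m fun t =>
    (mem_boxOpen c U _).2 fun i => by
      have : (c.proj i).base (m.base t) = _ := congr(($(hm i)).base t)
      rw [this]
      exact fromSpec_mem (hU i) _
  refine ⟨⟨l, m', ?_, ?_⟩, fun i => ?_⟩
  · rw [← cancel_mono (c.pt.ofRestrict (boxOpen c U).isOpenEmbedding)]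
    refine Fan.IsLimit.hom_ext hc _ _ fun i => ?_
    rw [Category.assoc l, hm', Category.assoc, hm, ← Category.assoc, hl, ha, Category.id_comp]
  -- `m' ≫ l` and the identity have the same components, as can be checked after composing with the
  -- monomorphisms `fromSpec`.
  · refine (existsUnique_lift_Spec_tensorRing (fun i => Γ(X i, U i)) fun i => m' ≫ a i).unique
      (fun i => by rw [Category.assoc, hl]) fun i => ?_
    rw [← cancel_mono (hU i).fromSpec.toLRSHom, Category.assoc, Category.assoc, ha,
      Category.id_comp, ← Category.assoc, hm', hm]
  · rw [Scheme.Hom.comp_toLRSHom, ← Category.assoc, hl, ha]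

end Product

/-! ### Local structure of equalizers -/

section Equalizer

variable {Y Z : Scheme.{u}} {f g : Y ⟶ Z} (c : Fork f.toLRSHom g.toLRSHom)

theorem exists_mem_forkOpen (x : c.pt) :
    ∃ (V : Y.Opens) (W : Z.Opens), IsAffineOpen V ∧ IsAffineOpen W ∧
      V ≤ f ⁻¹ᵁ W ∧ V ≤ g ⁻¹ᵁ W ∧ x ∈ forkOpen c V := by
  -- Because `f` and `g` agree at this point, a single affine `W` around the common image serves
  -- both.
  have hfg : f (c.ι.base x) = g (c.ι.base x) := congr(($(c.condition)).base x)
  obtain ⟨W, hW, hxW, -⟩ := exists_isAffineOpen_mem_and_subset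
    (x := f (c.ι.base x)) (U := ⊤) trivial
  obtain ⟨V, hV, hxV, hVW⟩ := exists_isAffineOpen_mem_and_subset
    (x := (c.ι.base x : Y)) (U := f ⁻¹ᵁ W ⊓ g ⁻¹ᵁ W) ⟨hxW, show g _ ∈ W from hfg ▸ hxW⟩
  exact ⟨V, W, hV, hW, fun _ h => (hVW h).1, fun _ h => (hVW h).2, hxV⟩

/-- Over `V`, equalizing `f` and `g` amounts to equalizing the maps of spectra to `Spec Γ(Z, W)`,
since `hW.fromSpec` is a monomorphism. The coequalizer ring represents this condition. -/
theorem exists_forkOpen_iso (hc : IsLimit c) {V : Y.Opens} {W : Z.Opens} (hV : IsAffineOpen V)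
    (hW : IsAffineOpen W) (hf : V ≤ f ⁻¹ᵁ W) (hg : V ≤ g ⁻¹ᵁ W) :
    ∃ e : c.pt.restrict (forkOpen c V).isOpenEmbedding ≅
        (Spec (coeqRing (f.appLE W V hf) (g.appLE W V hg))).toLocallyRingedSpace,
      c.pt.ofRestrict (forkOpen c V).isOpenEmbedding ≫ c.ι =
        e.hom ≫ (Spec.map (coeqRingProj (f.appLE W V hf) (g.appLE W V hg)) ≫
          hV.fromSpec).toLRSHom := by
  have hf' := congr(($(IsAffineOpen.SpecMap_appLE_fromSpec f hW hV hf)).toLRSHom)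
  have hg' := congr(($(IsAffineOpen.SpecMap_appLE_fromSpec g hW hV hg)).toLRSHom)
  rw [Scheme.Hom.comp_toLRSHom, Scheme.Hom.comp_toLRSHom] at hf' hg'
  obtain ⟨a, ha⟩ := exists_lift_fromSpec hV
    (c.pt.ofRestrict (forkOpen c V).isOpenEmbedding ≫ c.ι) fun t => t.2
  have hfg : a ≫ (Spec.map (f.appLE W V hf)).toLRSHom =
      a ≫ (Spec.map (g.appLE W V hg)).toLRSHom := by
    rw [← cancel_mono hW.fromSpec.toLRSHom, Category.assoc, Category.assoc, hf', hg',
      ← Category.assoc, ← Category.assoc, ha, Category.assoc, Category.assoc, c.condition]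
  obtain ⟨l, hl, -⟩ := existsUnique_lift_Spec_coeqRing _ _ a hfg
  let q := (Spec.map (coeqRingProj (f.appLE W V hf) (g.appLE W V hg))).toLRSHom
  have hq : q ≫ (Spec.map (f.appLE W V hf)).toLRSHom =
      q ≫ (Spec.map (g.appLE W V hg)).toLRSHom := by
    have := congr((Spec.map $(coeqRing_condition (f.appLE W V hf) (g.appLE W V hg))).toLRSHom)
    rwa [Spec.map_comp, Spec.map_comp, Scheme.Hom.comp_toLRSHom, Scheme.Hom.comp_toLRSHom] at this
  have hqV : (q ≫ hV.fromSpec.toLRSHom) ≫ f.toLRSHom =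
      (q ≫ hV.fromSpec.toLRSHom) ≫ g.toLRSHom := by
    rw [Category.assoc, Category.assoc, ← hf', ← hg', ← Category.assoc, hq, Category.assoc]
  let m := Fork.IsLimit.lift hc (q ≫ hV.fromSpec.toLRSHom) hqV
  have hm : m ≫ c.ι = q ≫ hV.fromSpec.toLRSHom := Fork.IsLimit.lift_ι hc
  obtain ⟨m', hm'⟩ := exists_lift_restrict (forkOpen c V) m fun t => by
    have : c.ι.base (m.base t) = _ := congr(($hm).base t)
    change c.ι.base (m.base t) ∈ V
    rw [this]
    exact fromSpec_mem hV _
  refine ⟨⟨l, m', ?_, ?_⟩, ?_⟩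
  · rw [← cancel_mono (c.pt.ofRestrict (forkOpen c V).isOpenEmbedding)]
    refine Fork.IsLimit.hom_ext hc ?_
    rw [Category.assoc l, hm', Category.assoc, hm, ← Category.assoc, hl, ha, Category.id_comp]
  · have ham : m' ≫ a = q := by
      rw [← cancel_mono hV.fromSpec.toLRSHom, Category.assoc, ha, ← Category.assoc, hm', hm]
    refine (existsUnique_lift_Spec_coeqRing (f.appLE W V hf) (g.appLE W V hg) (m' ≫ a)
      (by rw [ham, hq])).unique (by rw [Category.assoc, hl]) ?_
    rw [ham, Category.id_comp]
  · rw [Scheme.Hom.comp_toLRSHom, ← Category.assoc, hl, ha]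

end Equalizer

end SchemeLimits

theorem mainTheorem5 :
    -- schemes have finite limits, and the inclusion into locally ringed spaces preserves them
    HasFiniteLimits Scheme.{u} ∧
    PreservesFiniteLimits Scheme.forgetToLocallyRingedSpace.{u} ∧
    -- a finite diagram of schemes has a limit in locally ringed spaces, and every such limit is
    -- a scheme
    (∀ (J : Type) [SmallCategory J] [FinCategory J] (F : J ⥤ Scheme.{u}),
      HasLimit (F ⋙ Scheme.forgetToLocallyRingedSpace) ∧
      ∀ c : Cone (F ⋙ Scheme.forgetToLocallyRingedSpace), IsLimit c →
        SchemeLimits.IsScheme c.pt) ∧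
    -- finite products in locally ringed spaces are locally spectra of tensor products
    (∀ (ι : Type) [Fintype ι] [DecidableEq ι] (X : ι → Scheme.{u})
      (c : Fan fun i => (X i).toLocallyRingedSpace), IsLimit c →
      (∀ x : c.pt, ∃ U : ∀ i, (X i).Opens,
        (∀ i, IsAffineOpen (U i)) ∧ x ∈ SchemeLimits.boxOpen c U) ∧
      ∀ (U : ∀ i, (X i).Opens) (hU : ∀ i, IsAffineOpen (U i)),
        ∃ e : c.pt.restrict (SchemeLimits.boxOpen c U).isOpenEmbedding ≅
            (Spec (SchemeLimits.tensorRing fun i => Γ(X i, U i))).toLocallyRingedSpace,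
          ∀ i, c.pt.ofRestrict (SchemeLimits.boxOpen c U).isOpenEmbedding ≫ c.proj i =
            e.hom ≫ (Spec.map (SchemeLimits.tensorRingIncl (fun i => Γ(X i, U i)) i) ≫
              (hU i).fromSpec).toLRSHom) ∧
    -- equalizers in locally ringed spaces are locally spectra of coequalizer rings
    (∀ (Y Z : Scheme.{u}) (f g : Y ⟶ Z) (c : Fork f.toLRSHom g.toLRSHom), IsLimit c →
      (∀ x : c.pt, ∃ (V : Y.Opens) (W : Z.Opens), IsAffineOpen V ∧ IsAffineOpen W ∧
        V ≤ f ⁻¹ᵁ W ∧ V ≤ g ⁻¹ᵁ W ∧ x ∈ SchemeLimits.forkOpen c V) ∧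
      ∀ (V : Y.Opens) (W : Z.Opens) (hV : IsAffineOpen V) (_ : IsAffineOpen W)
        (hf : V ≤ f ⁻¹ᵁ W) (hg : V ≤ g ⁻¹ᵁ W),
        ∃ e : c.pt.restrict (SchemeLimits.forkOpen c V).isOpenEmbedding ≅
            (Spec (SchemeLimits.coeqRing (f.appLE W V hf) (g.appLE W V hg))).toLocallyRingedSpace,
          c.pt.ofRestrict (SchemeLimits.forkOpen c V).isOpenEmbedding ≫ c.ι =
            e.hom ≫ (Spec.map (SchemeLimits.coeqRingProj (f.appLE W V hf) (g.appLE W V hg)) ≫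
              hV.fromSpec).toLRSHom) := by
  refine ⟨inferInstance, inferInstance, fun J _ _ F => ?_, fun ι _ _ X c hc => ?_,
    fun Y Z f g c hc => ?_⟩
  -- The image of the limit of schemes is one limit in locally ringed spaces; every other is
  -- isomorphic to it.
  · let h := isLimitOfPreserves Scheme.forgetToLocallyRingedSpace (limit.isLimit F)
    exact ⟨⟨⟨_, h⟩⟩, fun c hc => SchemeLimits.isScheme_of_iso (hc.conePointUniqueUpToIso h)⟩
  · exact ⟨SchemeLimits.exists_mem_boxOpen c, SchemeLimits.exists_boxOpen_iso c hc⟩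
  · exact ⟨SchemeLimits.exists_mem_forkOpen c, fun V W hV hW hf hg =>
      SchemeLimits.exists_forkOpen_iso c hc hV hW hf hg⟩
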